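/- All quandles are finite; a quandle $Q$ has a right-distributive operation $a*b$, $R_a(y)=y*a$, and $\mathrm{Inn}(Q)$ is the group of permutations of $Q$ generated by all $R_a$, acting on $Q$ from the right ($a\mapsto ag$). $Q$ is connected if $\mathrm{Inn}(Q)$ is transitive on $Q$. $Q$ is a generalized Alexander quandle if it is isomorphic to a group $\Gamma$ with $a*b=f(ab^{-1})b$ for some $f\in\mathrm{Aut}(\Gamma)$. An oriented knot $K$ is given as the closure of an oriented 1-tangle (long knot) $T$ with a planar diagram running from top to bottom, with top arc $b_0$ and bottom arc $b_1$. A colouring of $T$ by $Q$ is a map $C$ from the arcs to $Q$ such that, at each crossing with over-arc coloured $y$, the incoming and outgoing under-arcs have colours $x$ and $x*y$ if the crossing is positive, and colours $x*y$ and $x$ if it is negative. For $e\in Q$ let $F_e=\{b\in Q: R_b=R_e\}$. Every colouring with $C(b_0)=e$ satisfies $C(b_1)\in F_e$, and $$\Psi_Q^e(K)=\sum_{C:\ C(b_0)=e} C(b_1)\in\mathbb Z[F_e],$$ where $\mathbb Z[F_e]$ is the free $\mathbb Z$-module with basis $F_e$. Let $\pi_K$ be the knot group of $K$, given by the Wirtinger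 presentation of the closed diagram (one generator per arc; under an arc $y$ at a crossing of sign $\varepsilon$ the generator $x$ becomes $y^{-\varepsilon}xy^{\varepsilon}$; the generators of $b_0$ and $b_1$ are identified), $m_K$ the meridian of $b_0$, and $l_K=m_K^{-w}\prod_j y_j^{\varepsilon_j}$ the preferred longitude, where $y_j$ are the over-arcs and $\varepsilon_j$ the signs at the successive under-passages met in going along $T$ from $b_0$ to $b_1$, and $w=\sum_j\varepsilon_j$ is the writhe. For a finite group $G$ and $x\in G$ let $\Lambda=C(x)\cap G'$, the intersection of the centralizer of $x$ with the derived subgroup. The knot colouring polynomial of Eisermann is $$P_G^x(K)=\sum_{\rho}\rho(l_K)\in\mathbb Z[\Lambda],$$ the sum being over all homomorphisms $\rho:\pi_K\to G$ with $\rho(m_K)=x$ (these satisfy $\rho(l_K)\in\Lambda$). Theorem. Let $Q$ be a finite connected generalized Alexander quandle, $e\in Q$, $G=\mathrm{Inn}(Q)$ and $x=R_e$. Then $\pi_e:\Lambda\to F_e$, $\pi_e(g)=eg$, is a bijection, so that its linear extension $(\pi_e)_*:\mathbb Z[\Lambda]\to\mathbb Z[F_e]$, $\sum n_g g\mapsto\sum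 n_g\pi_e(g)$, is an isomorphism of $\mathbb Z$-modules, and for every knot $K$ $$\Psi_Q^e(K)=(\pi_e)_*\bigl(P_G^x(K)\bigr).$$ Consequently, for all knots $K_1,K_2$, $\Psi_Q^e(K_1)\ne\Psi_Q^e(K_2)$ if and only if $P_G^x(K_1)\ne P_G^x(K_2)$. -/

import Mathlib

universe u v

/-! ### Quandles

We use Mathlib's `Quandle`, whose operation is written from the left.  In the right-handed notation
for quandles, `a * b` is `b ◃ a = Shelf.act b a`. -/

section Quandles

/-- The right-handed quandle operation `a * b`. -/
def qop {Q : Type u} [Quandle Q] (a b : Q) : Q := Shelf.act b a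

/-- The right translation `R_a : y ↦ y * a`, as an element of the group of permutations of `Q`
acting on `Q` from the right (so that `g * h` means first `g`, then `h`); this is the opposite of
Mathlib's `Equiv.Perm Q`. -/
def rightTranslation {Q : Type u} [Quandle Q] (a : Q) : (Equiv.Perm Q)ᵐᵒᵖ :=
  MulOpposite.op (Rack.act' a)

/-- The inner automorphism group `Inn(Q)`, generated by the right translations and acting on `Q`
from the right. -/
def Inn (Q : Type u) [Quandle Q] : Subgroup (Equiv.Perm Q)ᵐᵒᵖ :=
  Subgroup.closure (Set.range (rightTranslation (Q := Q)))

/-- The inner representation `inn : Q → Inn(Q)`, `a ↦ R_a`. -/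
def inn {Q : Type u} [Quandle Q] (a : Q) : Inn Q :=
  ⟨rightTranslation a, Subgroup.subset_closure ⟨a, rfl⟩⟩

/-- `a g`, the image of `a ∈ Q` under `g ∈ Inn(Q)`. -/
def innApply {Q : Type u} [Quandle Q] (a : Q) (g : Inn Q) : Q := g.1.unop a

/-- `Q` is connected: `Inn(Q)` acts transitively on `Q`. -/
def IsConnectedQuandle (Q : Type u) [Quandle Q] : Prop :=
  ∀ a b : Q, ∃ g : Inn Q, innApply a g = b

/-- The underlying set of the generalized Alexander quandle `GAlex(Γ, f)`. -/
def GAlex (Γ : Type u) [Group Γ] (_f : Γ ≃* Γ) : Type u := Γ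

/-- The operation `a * b = f (a b⁻¹) b` on a group. -/
def galexOp {Γ : Type u} [Group Γ] (f : Γ ≃* Γ) (a b : Γ) : Γ := f (a * b⁻¹) * b

/-- `GAlex(Γ, f)`: the group `Γ` with `a * b = f (a b⁻¹) b`. -/
instance GAlex.instQuandle (Γ : Type u) [Group Γ] (f : Γ ≃* Γ) : Quandle (GAlex Γ f) where
  act b a := galexOp (Γ := Γ) f a b
  self_distrib := by
    intro x y z
    change Γ at x y z
    change f (f (z * y⁻¹) * y * x⁻¹) * x =
      f (f (z * x⁻¹) * x * (f (y * x⁻¹) * x)⁻¹) * (f (y * x⁻¹) * x)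
    simp [mul_assoc]
  invAct b a := galexOp (Γ := Γ) f.symm a b
  left_inv := by
    intro x y
    change Γ at x y
    change f.symm (f (y * x⁻¹) * x * x⁻¹) * x = y
    simp
  right_inv := by
    intro x y
    change Γ at x y
    change f (f.symm (y * x⁻¹) * x * x⁻¹) * x = y
    simp
  fix := by
    intro x
    change Γ at x
    change f (x * x⁻¹) * x = x
    simp

/-- `Q` is (isomorphic to) a generalized Alexander quandle. -/
def IsGeneralizedAlexander (Q : Type u) [Quandle Q] : Prop :=
  ∃ (Γ : Type u) (_ : Group Γ) (f : Γ ≃* Γ) (φ : ShelfHom Q (GAlex Γ f)),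
    Function.Bijective φ.toFun

/-- The fibre `F_e = inn⁻¹(R_e)`. -/
abbrev Fiber {Q : Type u} [Quandle Q] (e : Q) : Type u := {b : Q // inn b = inn e}

theorem inn_act {Q : Type u} [Quandle Q] (a b : Q) :
    inn (qop a b) = (inn b)⁻¹ * inn a * inn b := by
  apply Subtype.ext
  apply MulOpposite.unop_injective
  change Rack.act' (Shelf.act b a) = Rack.act' b * (Rack.act' a * (Rack.act' b)⁻¹)
  rw [Rack.ad_conj, mul_assoc]

theorem inn_innApply {Q : Type u} [Quandle Q] (a : Q) (g : Inn Q) :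
    inn (innApply a g) = g⁻¹ * inn a * g := by
  obtain ⟨g, hg⟩ := g
  induction hg using Subgroup.closure_induction generalizing a with
  | mem g hg =>
    obtain ⟨b, rfl⟩ := hg
    exact inn_act a b
  | one =>
    apply Subtype.ext
    simp [innApply]
  | mul g h hg hh ihg ihh =>
    have h1 := ihh (innApply a ⟨g, hg⟩)
    rw [ihg] at h1
    refine Eq.trans h1 ?_
    apply Subtype.ext
    simp [mul_assoc]
  | inv g hg ih =>
    have h1 := ih (innApply a ⟨g⁻¹, inv_mem hg⟩)
    have h2 : innApply (innApply a ⟨g⁻¹, inv_mem hg⟩) ⟨g, hg⟩ = a := by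
      simp [innApply]
    rw [h2] at h1
    rw [h1]
    apply Subtype.ext
    simp [mul_assoc]

end Quandles

/-! ### Diagrams of oriented 1-tangles (long knots) -/

/-- A signed Gauss code of a long knot with `n` crossings.  Traversing the long knot from its top
end to its bottom end one meets the crossings in `2 n` passages; passage `t` runs through the
crossing `(passage t).1`, along the over-strand if `(passage t).2 = true` and along the
under-strand otherwise.  The passages cut the long knot into the edges `0, …, 2 n`; passage `t`
leads from edge `t` to edge `t + 1`. -/
structure GaussCode where
  n : ℕ
  passage : Fin (2 * n) ≃ Fin n × Bool
  sign : Fin n → ℤˣ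

namespace GaussCode

variable (D : GaussCode)

abbrev Edge : Type := Fin (2 * D.n + 1)

/-- The edge of the top end. -/
def topEdge : D.Edge := 0

/-- The edge of the bottom end. -/
def bottomEdge : D.Edge := Fin.last (2 * D.n)

/-- The edges before and after the passage along the over-strand of a crossing, and those before
and after the passage along its under-strand. -/
def overIn (c : Fin D.n) : D.Edge := (D.passage.symm (c, true)).castSucc
def overOut (c : Fin D.n) : D.Edge := (D.passage.symm (c, true)).succ
def underIn (c : Fin D.n) : D.Edge := (D.passage.symm (c, false)).castSucc
def underOut (c : Fin D.n) : D.Edge := (D.passage.symm (c, false)).succ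

/-- `1` for a strand running downwards, `-1` for a strand running upwards. -/
def dirSign (d : Bool) : ℤˣ := if d then 1 else -1

/-- `D.Drawn L X`: the crossings in `X` have been drawn, each exactly once, in a planar picture of
an initial part of the long knot, made by sweeping a horizontal line downwards through the strip
from the top end; `L` lists, from left to right, the strands that cross the present line, each with
the edge it belongs to and its direction (`true` for downwards).  Going down, the line passes local
maxima, local minima and crossings. -/
inductive Drawn : List (D.Edge × Bool) → List (Fin D.n) → Prop
  | start : Drawn [(D.topEdge, true)] []
  | maximum (L R : List (D.Edge × Bool)) (X : List (Fin D.n)) (i : D.Edge) (d : Bool) :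
      Drawn (L ++ R) X → Drawn (L ++ (i, d) :: (i, !d) :: R) X
  | minimum (L R : List (D.Edge × Bool)) (X : List (Fin D.n)) (i : D.Edge) (d : Bool) :
      Drawn (L ++ (i, d) :: (i, !d) :: R) X → Drawn (L ++ R) X
  /-- A crossing whose over-strand joins the upper left to the lower right.  If both strands run
  downwards, such a crossing is negative. -/
  | crossingOverFromLeft (L R : List (D.Edge × Bool)) (X : List (Fin D.n)) (c : Fin D.n)
      (d d' : Bool) (hc : c ∉ X) (hsign : D.sign c = -(dirSign d * dirSign d')) :
      Drawn (L ++ (if d then D.overIn c else D.overOut c, d) ::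
        (if d' then D.underIn c else D.underOut c, d') :: R) X →
      Drawn (L ++ (if d' then D.underOut c else D.underIn c, d') ::
        (if d then D.overOut c else D.overIn c, d) :: R) (c :: X)
  /-- A crossing whose over-strand joins the upper right to the lower left.  If both strands run
  downwards, such a crossing is positive. -/
  | crossingOverFromRight (L R : List (D.Edge × Bool)) (X : List (Fin D.n)) (c : Fin D.n)
      (d d' : Bool) (hc : c ∉ X) (hsign : D.sign c = dirSign d * dirSign d') :
      Drawn (L ++ (if d' then D.underIn c else D.underOut c, d') ::
        (if d then D.overIn c else D.overOut c, d) :: R) X →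
      Drawn (L ++ (if d then D.overOut c else D.overIn c, d) ::
        (if d' then D.underOut c else D.underIn c, d') :: R) (c :: X)

/-- The Gauss code is that of a diagram in the plane: it can be drawn from the top end to the
bottom end, with all its crossings and no others. -/
def IsPlanar : Prop :=
  ∃ X : List (Fin D.n), (∀ c, c ∈ X) ∧ D.Drawn [(D.bottomEdge, true)] X

/-- The Wirtinger relations for a family of elements of a group indexed by the edges: the element
does not change along an over-passage, and it is conjugated by the element of the over-strand
along an under-passage. -/
def IsWirtinger {G : Type v} [Group G] (y : D.Edge → G) : Prop :=
  ∀ c, y (D.overOut c) = y (D.overIn c) ∧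
    y (D.underOut c) =
      y (D.overIn c) ^ (-(D.sign c : ℤ)) * y (D.underIn c) * y (D.overIn c) ^ (D.sign c : ℤ)

/-- The relators of the Wirtinger presentation of the closure. -/
inductive Relator : FreeGroup D.Edge → Prop
  | over (c : Fin D.n) :
      Relator (FreeGroup.of (D.overOut c) * (FreeGroup.of (D.overIn c))⁻¹)
  | under (c : Fin D.n) :
      Relator (FreeGroup.of (D.underOut c) *
        (FreeGroup.of (D.overIn c) ^ (-(D.sign c : ℤ)) * FreeGroup.of (D.underIn c) *
          FreeGroup.of (D.overIn c) ^ (D.sign c : ℤ))⁻¹)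
  | closing : Relator (FreeGroup.of D.bottomEdge * (FreeGroup.of D.topEdge)⁻¹)

/-- The knot group of the closure, by its Wirtinger presentation: generators the (meridians of the)
edges, the Wirtinger relations at the crossings, and the identification of the two end edges. -/
abbrev KnotGroup : Type := PresentedGroup {r | D.Relator r}

/-- The generator of the knot group belonging to an edge. -/
def gen (i : D.Edge) : D.KnotGroup := PresentedGroup.of i

/-- The meridian `m_K` (at the top end). -/
def meridian : D.KnotGroup := D.gen D.topEdge

/-- The contribution of a passage to the parallel of the knot: passing under the edge `i` at a
crossing of sign `ε` contributes the factor `i ^ ε`. -/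
def parallelFactor (t : Fin (2 * D.n)) : D.KnotGroup :=
  if (D.passage t).2 then 1
  else D.gen (D.overIn (D.passage t).1) ^ (D.sign (D.passage t).1 : ℤ)

/-- The writhe. -/
def writhe : ℤ := ∑ c, (D.sign c : ℤ)

/-- The (preferred) longitude `l_K`: the parallel read along the knot from the top end to the
bottom end, corrected by a power of the meridian to have linking number zero with the knot. -/
def longitude : D.KnotGroup :=
  D.meridian ^ (-D.writhe) * (List.ofFn D.parallelFactor).prod

/-- A colouring by a quandle.  The arcs of the diagram are the unions of edges that are consecutive
through over-passages, so a map on the arcs is a map on the edges that does not change along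
over-passages.  At an under-passage the colour `x` becomes `x * y` where `y` is the colour of the
over-strand, if the crossing is positive; at a negative crossing the roles of the two under-edges
are exchanged. -/
def IsColoring {Q : Type u} [Quandle Q] (C : D.Edge → Q) : Prop :=
  ∀ c, C (D.overOut c) = C (D.overIn c) ∧
    (D.sign c = 1 → C (D.underOut c) = qop (C (D.underIn c)) (C (D.overIn c))) ∧
    (D.sign c = -1 → C (D.underIn c) = qop (C (D.underOut c)) (C (D.overIn c)))

/-- `Col_Q^e(T)`: the colourings with the colour `e` at the top end. -/
abbrev ColoringFrom {Q : Type u} [Quandle Q] (e : Q) : Type u :=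
  {C : D.Edge → Q // D.IsColoring C ∧ C D.topEdge = e}

end GaussCode

/-- A diagram of an oriented 1-tangle, running from top to bottom; its closure is an oriented knot,
and every oriented knot arises in this way. -/
structure TangleDiagram extends GaussCode where
  isPlanar : toGaussCode.IsPlanar

/-! ### Facts which make the two invariants well defined -/

namespace GaussCode

variable {D : GaussCode}

/-- The product of the elements of the strands on a line. -/
def lineProd {G : Type v} [Group G] (y : D.Edge → G) (L : List (D.Edge × Bool)) : G :=
  (L.map fun s => if s.2 then y s.1 else (y s.1)⁻¹).prod

theorem IsWirtinger.lineProd_eq {G : Type v} [Group G] {y : D.Edge → G} (hy : D.IsWirtinger y)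
    {L : List (D.Edge × Bool)} {X : List (Fin D.n)} (h : D.Drawn L X) :
    lineProd y L = y D.topEdge := by
  induction h with
  | start => simp [lineProd]
  | maximum L R X i d _ ih =>
    rw [← ih]
    cases d <;> simp [lineProd]
  | minimum L R X i d _ ih =>
    rw [← ih]
    cases d <;> simp [lineProd]
  | crossingOverFromLeft L R X c d d' hc hsign _ ih =>
    obtain ⟨h1, h2⟩ := hy c
    rw [← ih]
    cases d <;> cases d' <;> simp [dirSign] at hsign <;>
      simp [lineProd, h1, h2, hsign, mul_assoc]
  | crossingOverFromRight L R X c d d' hc hsign _ ih =>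
    obtain ⟨h1, h2⟩ := hy c
    rw [← ih]
    cases d <;> cases d' <;> simp [dirSign] at hsign <;>
      simp [lineProd, h1, h2, hsign, mul_assoc]

theorem IsWirtinger.bottom_eq_top {G : Type v} [Group G] {y : D.Edge → G} (hy : D.IsWirtinger y)
    (hD : D.IsPlanar) : y D.bottomEdge = y D.topEdge := by
  obtain ⟨X, -, hX⟩ := hD
  simpa [lineProd] using hy.lineProd_eq hX

theorem IsColoring.isWirtinger {Q : Type u} [Quandle Q] {C : D.Edge → Q} (hC : D.IsColoring C) :
    D.IsWirtinger fun i => inn (C i) := by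
  intro c
  obtain ⟨h1, h2, h3⟩ := hC c
  refine ⟨by simp [h1], ?_⟩
  rcases Int.units_eq_one_or (D.sign c) with h | h
  · simp [h, h2 h, inn_act]
  · simp [h, h3 h, inn_act, mul_assoc]

theorem isWirtinger_gen (D : GaussCode) : D.IsWirtinger D.gen := by
  intro c
  constructor
  · exact mul_inv_eq_one.mp (PresentedGroup.one_of_mem (Relator.over c))
  · exact mul_inv_eq_one.mp (PresentedGroup.one_of_mem (Relator.under c))

theorem gen_bottomEdge (D : GaussCode) : D.gen D.bottomEdge = D.meridian :=
  mul_inv_eq_one.mp (PresentedGroup.one_of_mem Relator.closing)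

theorem gen_eq_conj (D : GaussCode) (k : ℕ) (hk : k < 2 * D.n + 1) :
    D.gen ⟨k, hk⟩ = ((List.ofFn D.parallelFactor).take k).prod⁻¹ * D.meridian *
      ((List.ofFn D.parallelFactor).take k).prod := by
  induction k with
  | zero => simp [meridian, topEdge]
  | succ k ih =>
    have hk' : k < 2 * D.n := by omega
    have ih := ih (by omega)
    rw [List.prod_take_succ _ _ (by simpa using hk')]
    simp only [List.getElem_ofFn]
    set t : Fin (2 * D.n) := ⟨k, hk'⟩ with ht
    set g := ((List.ofFn D.parallelFactor).take k).prod
    have e1 : (⟨k, by omega⟩ : D.Edge) = t.castSucc := rfl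
    have e2 : (⟨k + 1, hk⟩ : D.Edge) = t.succ := rfl
    rw [e1] at ih
    rw [e2]
    rcases h : D.passage t with ⟨c, b⟩
    have hc : t = D.passage.symm (c, b) := by rw [← h]; simp
    obtain ⟨h1, h2⟩ := D.isWirtinger_gen c
    cases b
    · have hin : D.underIn c = t.castSucc := by rw [hc]; rfl
      have hout : D.underOut c = t.succ := by rw [hc]; rfl
      rw [hin, hout, ih] at h2
      simp [parallelFactor, h, h2, mul_assoc]
    · have hin : D.overIn c = t.castSucc := by rw [hc]; rfl
      have hout : D.overOut c = t.succ := by rw [hc]; rfl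
      rw [hin, hout, ih] at h1
      simp [parallelFactor, h, h1]

theorem commute_meridian_longitude (D : GaussCode) : D.meridian * D.longitude =
    D.longitude * D.meridian := by
  have h := D.gen_eq_conj (2 * D.n) (by omega)
  rw [List.take_of_length_le (by simp)] at h
  have h' : D.gen ⟨2 * D.n, by omega⟩ = D.meridian := D.gen_bottomEdge
  rw [h'] at h
  set g := (List.ofFn D.parallelFactor).prod with hg
  have hc : Commute D.meridian g := by
    have h3 : g * D.meridian = g * (g⁻¹ * D.meridian * g) := by rw [← h]
    rw [mul_assoc, mul_inv_cancel_left] at h3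
    exact h3.symm
  have hm : Commute D.meridian (D.meridian ^ (-D.writhe)) := (Commute.refl _).zpow_right _
  exact hm.mul_right hc

theorem longitude_mem_commutator (D : GaussCode) : D.longitude ∈ commutator D.KnotGroup := by
  rw [← Abelianization.ker_of, MonoidHom.mem_ker]
  set a := Abelianization.of (G := D.KnotGroup)
  have hgen : ∀ i, a (D.gen i) = a D.meridian := by
    rintro ⟨k, hk⟩
    rw [D.gen_eq_conj k hk, map_mul, map_mul, map_inv, mul_right_comm, inv_mul_cancel, one_mul]
  have hf : ∀ t, a (D.parallelFactor t) =
      (fun p : Fin D.n × Bool => if p.2 then 1 else a D.meridian ^ (D.sign p.1 : ℤ))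
        (D.passage t) := by
    intro t
    unfold parallelFactor
    split_ifs with h
    · simp [h]
    · simp [h, hgen]
  have hprod : a (List.ofFn D.parallelFactor).prod = a D.meridian ^ D.writhe := by
    rw [map_list_prod, List.map_ofFn, List.prod_ofFn]
    simp only [Function.comp_apply, hf]
    refine (Equiv.prod_comp D.passage (fun p : Fin D.n × Bool =>
      if p.2 then 1 else a D.meridian ^ (D.sign p.1 : ℤ))).trans ?_
    rw [Fintype.prod_prod_type]
    have hs : ∀ s : Finset (Fin D.n),
        ∏ c ∈ s, a D.meridian ^ (D.sign c : ℤ) = a D.meridian ^ ∑ c ∈ s, (D.sign c : ℤ) := by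
      intro s
      induction s using Finset.induction_on with
      | empty => simp
      | insert c s hc ih => rw [Finset.prod_insert hc, Finset.sum_insert hc, zpow_add, ih]
    simpa [writhe] using hs Finset.univ
  rw [longitude, map_mul, hprod, map_zpow, ← zpow_add, neg_add_cancel, zpow_zero]

end GaussCode

/-- The longitude group `Λ = C(x) ∩ G'` of a pointed group `(G, x)`. -/
def LongitudeGroup {G : Type v} [Group G] (x : G) : Subgroup G :=
  Subgroup.centralizer {x} ⊓ commutator G

theorem map_longitude_mem {G : Type v} [Group G] {x : G} (D : GaussCode)
    (ρ : D.KnotGroup →* G) (hρ : ρ D.meridian = x) : ρ D.longitude ∈ LongitudeGroup x := by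
  refine ⟨?_, ?_⟩
  · change ρ D.longitude ∈ Subgroup.centralizer {x}
    rw [Subgroup.mem_centralizer_singleton_iff, ← hρ, ← map_mul, ← map_mul,
      D.commute_meridian_longitude]
  · have h := Subgroup.mem_map_of_mem ρ D.longitude_mem_commutator
    rw [commutator_def, Subgroup.map_commutator] at h
    exact Subgroup.commutator_mono le_top le_top h

instance finite_inn {Q : Type u} [Quandle Q] [Finite Q] : Finite (Inn Q) :=
  have : Finite (Equiv.Perm Q)ᵐᵒᵖ := Finite.of_equiv _ MulOpposite.opEquiv
  inferInstance

instance finite_hom {α : Type*} [Finite α] {G : Type v} [Group G] [Finite G]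
    (rels : Set (FreeGroup α)) : Finite (PresentedGroup rels →* G) :=
  Finite.of_injective (fun ρ (i : α) => ρ (PresentedGroup.of i)) fun _ _ h =>
    PresentedGroup.ext fun i => congrFun h i

theorem innApply_mem_fiber {Q : Type u} [Quandle Q] (e : Q) (g : LongitudeGroup (inn e)) :
    inn (innApply e g.1) = inn e := by
  have h := Subgroup.mem_centralizer_singleton_iff.mp g.2.1
  rw [inn_innApply, mul_assoc, ← h, inv_mul_cancel_left]

/-! ### The two invariants -/

noncomputable section Invariants

/-- The knot colouring polynomial `P_G^x(K) = ∑_ρ ρ(l_K) ∈ ℤ[Λ]` of the closure `K` of `T`; the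
sum is over the homomorphisms `ρ` from the knot group to the finite group `G` with
`ρ(m_K) = x`. -/
def knotColoringPolynomial {G : Type v} [Group G] [Finite G] (x : G) (T : TangleDiagram) :
    MonoidAlgebra ℤ (LongitudeGroup x) :=
  letI := Fintype.ofFinite {ρ : T.KnotGroup →* G // ρ T.meridian = x}
  ∑ ρ : {ρ : T.KnotGroup →* G // ρ T.meridian = x},
    MonoidAlgebra.single ⟨ρ.1 T.longitude, map_longitude_mem T.toGaussCode ρ.1 ρ.2⟩ 1

/-- The invariant `Ψ_Q^e(K) = ∑_C C(b₁)` of the closure `K` of `T`, in the free `ℤ`-module with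
basis the fibre `F_e`; the sum is over the colourings `C` of `T` by the finite quandle `Q` with the
colour `e` at the top arc, and `b₁` is the bottom arc. -/
def psiInvariant {Q : Type u} [Quandle Q] [Finite Q] (e : Q) (T : TangleDiagram) :
    Fiber e →₀ ℤ :=
  letI := Fintype.ofFinite (T.ColoringFrom e)
  ∑ C : T.ColoringFrom e,
    Finsupp.single ⟨C.1 T.bottomEdge, by
      have h := C.2.1.isWirtinger.bottom_eq_top T.isPlanar
      rw [h, C.2.2]⟩ 1

/-- The map `π_e : Λ → F_e`, `π_e(g) = e g`. -/
def fiberMap {Q : Type u} [Quandle Q] (e : Q) (g : LongitudeGroup (inn e)) : Fiber e :=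
  ⟨innApply e g.1, innApply_mem_fiber e g⟩

/-- The `ℤ`-linear extension `(π_e)_* : ℤ[Λ] → ℤ[F_e]`, `∑ n_g g ↦ ∑ n_g π_e(g)`. -/
def fiberMapLinear {Q : Type u} [Quandle Q] (e : Q) :
    MonoidAlgebra ℤ (LongitudeGroup (inn e)) →ₗ[ℤ] (Fiber e →₀ ℤ) :=
  Finsupp.lmapDomain ℤ ℤ (fiberMap e) ∘ₗ (MonoidAlgebra.coeffLinearEquiv ℤ).toLinearMap

end Invariants

/-! ### The action of the inner automorphism group -/

section InnerAction

variable {Q : Type u} [Quandle Q]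

/-! Two independent facts combine. First, for every finite quandle, colourings with top colour `e`
correspond to homomorphisms `ρ` with `ρ(m) = R_e`. A colouring `C` gives `ρ` by sending the
generator of an edge to `R` of its colour. Conversely each under-passage acts on the colour by `ρ`
of one factor of the parallel, so `C i = e · ρ(partial parallel up to i)`. At the bottom edge the
correction `m ^ (-w)` costs nothing, as `R_e` fixes `e`; hence `C(b₁) = e · ρ(l)`
(`coloringOfHom_bijective`, `coloringOfHom_bottomEdge`).

Second, `G'` acts simply transitively on `Q`. Connectedness makes all `R_a` conjugate, so `G` is
generated by `G'` and `R_e`, and `G'` is already transitive. In coordinates from `Γ`, inner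
automorphisms are `a ↦ f ^ k (a) γ` with `k` additive, so elements of `G'` are right translations
and act freely. Since `e g ∈ F_e` exactly when `g` centralizes `R_e`, `Λ` corresponds to `F_e`. -/

theorem innApply_one (a : Q) : innApply a 1 = a := rfl

theorem innApply_mul (a : Q) (g h : Inn Q) :
    innApply a (g * h) = innApply (innApply a g) h := rfl

theorem innApply_inn (a b : Q) : innApply a (inn b) = qop a b := rfl

theorem innApply_inv_innApply (a : Q) (g : Inn Q) : innApply (innApply a g) g⁻¹ = a := by
  rw [← innApply_mul, mul_inv_cancel, innApply_one]

theorem innApply_innApply_inv (a : Q) (g : Inn Q) : innApply (innApply a g⁻¹) g = a := by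
  rw [← innApply_mul, inv_mul_cancel, innApply_one]

theorem innApply_inn_self (e : Q) : innApply e (inn e) = e := Quandle.fix

/-- This lets powers of `R_e` be discarded twice: in moving an element of `Inn Q` into the derived
subgroup, and in dropping the writhe correction of the longitude. -/
theorem innApply_inn_zpow (e : Q) (k : ℤ) : innApply e (inn e ^ k) = e := by
  induction k using Int.induction_on with
  | zero => rw [zpow_zero, innApply_one]
  | succ k ih => rw [zpow_add_one, innApply_mul, ih, innApply_inn_self]
  | pred k ih =>
    rw [zpow_sub_one, innApply_mul, ih]
    have h := innApply_inv_innApply e (inn e)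
    rwa [innApply_inn_self] at h

theorem Inn.induction {p : Inn Q → Prop} (hinn : ∀ a, p (inn a)) (hone : p 1)
    (hmul : ∀ g h, p g → p h → p (g * h)) (hinv : ∀ g, p g → p g⁻¹) (g : Inn Q) : p g := by
  obtain ⟨g, hg⟩ := g
  induction hg using Subgroup.closure_induction with
  | mem g hg =>
    obtain ⟨a, rfl⟩ := hg
    exact hinn a
  | one => exact hone
  | mul g h _ _ ihg ihh => exact hmul _ _ ihg ihh
  | inv g _ ih => exact hinv _ ih

/-- In a connected quandle, `Inn(Q)` is generated by its derived subgroup and any `R_e`. -/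
theorem IsConnectedQuandle.exists_zpow_mul_mem_commutator (hconn : IsConnectedQuandle Q) (e : Q)
    (g : Inn Q) : ∃ k : ℤ, inn e ^ k * g ∈ commutator (Inn Q) := by
  suffices h : ∃ k : ℤ, Abelianization.of g = Abelianization.of (inn e) ^ k by
    obtain ⟨k, hk⟩ := h
    refine ⟨-k, ?_⟩
    rw [← Abelianization.ker_of, MonoidHom.mem_ker, map_mul, map_zpow, hk, ← zpow_add,
      neg_add_cancel, zpow_zero]
  induction g using Inn.induction with
  | hinn a =>
    -- Connectedness makes `R_a` a conjugate of `R_e`, so both have the same class in the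
    -- abelianization.
    obtain ⟨h, rfl⟩ := hconn e a
    refine ⟨1, ?_⟩
    rw [inn_innApply, map_mul, map_mul, map_inv, mul_right_comm, inv_mul_cancel, one_mul, zpow_one]
  | hone => exact ⟨0, by simp⟩
  | hmul g h ihg ihh =>
    obtain ⟨j, hj⟩ := ihg
    obtain ⟨k, hk⟩ := ihh
    exact ⟨j + k, by rw [map_mul, hj, hk, zpow_add]⟩
  | hinv g ih =>
    obtain ⟨k, hk⟩ := ih
    exact ⟨-k, by rw [map_inv, hk, zpow_neg]⟩

/-- The derived subgroup of `Inn(Q)` acts transitively on a connected quandle. -/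
theorem IsConnectedQuandle.exists_mem_commutator (hconn : IsConnectedQuandle Q) (e b : Q) :
    ∃ g ∈ commutator (Inn Q), innApply e g = b := by
  obtain ⟨g, rfl⟩ := hconn e b
  obtain ⟨k, hk⟩ := hconn.exists_zpow_mul_mem_commutator e g
  exact ⟨_, hk, by rw [innApply_mul, innApply_inn_zpow]⟩

/-- In the coordinates `φ : Q → Γ`, the inner automorphism `g` has the form
`a ↦ f ^ k (a) γ` for some `γ`. -/
def IsAffineOfDegree {Γ : Type v} [Group Γ] (f : MulAut Γ) (φ : Q → Γ) (k : ℤ) (g : Inn Q) : Prop :=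
  ∃ γ : Γ, ∀ a, φ (innApply a g) = (f ^ k) (φ a) * γ

/-! ### Affine form and degree of inner automorphisms -/

namespace IsAffineOfDegree

variable {Γ : Type v} [Group Γ] {f : MulAut Γ} {φ : Q → Γ} {j k : ℤ} {g h : Inn Q}

theorem one : IsAffineOfDegree f φ 0 (1 : Inn Q) :=
  ⟨1, fun a => by simp [innApply_one]⟩

theorem mul (hg : IsAffineOfDegree f φ j g) (hh : IsAffineOfDegree f φ k h) :
    IsAffineOfDegree f φ (j + k) (g * h) := by
  obtain ⟨γ, hγ⟩ := hg
  obtain ⟨δ, hδ⟩ := hh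
  refine ⟨(f ^ k) γ * δ, fun a => ?_⟩
  rw [innApply_mul, hδ, hγ, map_mul, add_comm, zpow_add, MulAut.mul_apply, mul_assoc]

theorem inv (hg : IsAffineOfDegree f φ k g) : IsAffineOfDegree f φ (-k) g⁻¹ := by
  obtain ⟨γ, hγ⟩ := hg
  -- Solving `b = f ^ k (a) γ` for `a` gives `f ^ (-k) (b) · f ^ (-k) (γ⁻¹)`.
  refine ⟨(f ^ (-k)) γ⁻¹, fun a => ?_⟩
  have h := hγ (innApply a g⁻¹)
  rw [innApply_innApply_inv] at h
  rw [h, ← map_mul, mul_inv_cancel_right, ← MulAut.mul_apply, ← zpow_add, neg_add_cancel,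
    zpow_zero, MulAut.one_apply]

theorem exists_degree (hφ : ∀ a b, φ (qop a b) = f (φ a * (φ b)⁻¹) * φ b) (g : Inn Q) :
    ∃ k, IsAffineOfDegree f φ k g := by
  induction g using Inn.induction with
  | hinn b =>
    refine ⟨1, f (φ b)⁻¹ * φ b, fun a => ?_⟩
    rw [innApply_inn, hφ, zpow_one, map_mul, mul_assoc]
  | hone => exact ⟨0, one⟩
  | hmul g h ihg ihh =>
    obtain ⟨j, hj⟩ := ihg
    obtain ⟨k, hk⟩ := ihh
    exact ⟨j + k, hj.mul hk⟩
  | hinv g ih =>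
    obtain ⟨k, hk⟩ := ih
    exact ⟨-k, hk.inv⟩

/-- Degrees add, so a commutator has degree `j + k - j - k = 0`. A degree need not be unique when
`f` has finite order, so the elements admitting degree `0` are used as a subgroup instead of the
kernel of a degree map. -/
theorem of_mem_commutator (hφ : ∀ a b, φ (qop a b) = f (φ a * (φ b)⁻¹) * φ b)
    (hg : g ∈ commutator (Inn Q)) : IsAffineOfDegree f φ 0 g := by
  let N : Subgroup (Inn Q) :=
    { carrier := {g | IsAffineOfDegree f φ 0 g}
      one_mem' := one
      mul_mem' := fun hg hh => by simpa using mul hg hh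
      inv_mem' := fun hg => by simpa using inv hg }
  suffices h : commutator (Inn Q) ≤ N from h hg
  rw [commutator_def, Subgroup.commutator_le]
  intro g _ h _
  obtain ⟨j, hj⟩ := exists_degree hφ g
  obtain ⟨k, hk⟩ := exists_degree hφ h
  have hc := ((hj.mul hk).mul hj.inv).mul hk.inv
  rwa [show j + k + -j + -k = 0 by ring, ← commutatorElement_def] at hc

end IsAffineOfDegree

/-- The derived subgroup of `Inn(Q)` acts freely on a generalized Alexander quandle. -/
theorem IsGeneralizedAlexander.eq_one_of_innApply_eq (hGAlex : IsGeneralizedAlexander Q) {e : Q}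
    {g : Inn Q} (hg : g ∈ commutator (Inn Q)) (he : innApply e g = e) : g = 1 := by
  obtain ⟨Γ, _, f, φ, hφ, hinj⟩ : ∃ (Γ : Type u) (_ : Group Γ) (f : MulAut Γ) (φ : Q → Γ),
      (∀ a b, φ (qop a b) = f (φ a * (φ b)⁻¹) * φ b) ∧ Function.Injective φ := by
    obtain ⟨Γ, _, f, φ, hφ⟩ := hGAlex
    exact ⟨Γ, _, f, φ.toFun, fun a b => φ.map_act' (x := b) (y := a), hφ.1⟩
  -- In coordinates `g` is right translation by `γ`; fixing one point forces `γ = 1`.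
  obtain ⟨γ, hγ⟩ := IsAffineOfDegree.of_mem_commutator hφ hg
  have h := hγ e
  rw [he, zpow_zero, MulAut.one_apply, left_eq_mul] at h
  apply Subtype.ext
  apply MulOpposite.unop_injective
  ext a
  apply hinj
  refine (hγ a).trans ?_
  rw [h, mul_one, zpow_zero]
  rfl

/-! ### Bijectivity of `π_e` and of its linear extension -/

theorem fiberMap_bijective (hconn : IsConnectedQuandle Q) (hGAlex : IsGeneralizedAlexander Q)
    (e : Q) : Function.Bijective (fiberMap e) := by
  constructor
  · intro g h hgh
    have hgh : innApply e g.1 = innApply e h.1 := congrArg Subtype.val hgh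
    apply Subtype.ext
    rw [← mul_inv_eq_one]
    refine hGAlex.eq_one_of_innApply_eq (e := e) (mul_mem g.2.2 (inv_mem h.2.2)) ?_
    rw [innApply_mul, hgh, innApply_inv_innApply]
  · rintro ⟨b, hb⟩
    obtain ⟨g, hg, rfl⟩ := hconn.exists_mem_commutator e b
    refine ⟨⟨g, ?_, hg⟩, rfl⟩
    -- As `R_{eg} = g⁻¹ R_e g`, lying in the fibre means that `g` commutes with `R_e`.
    rw [inn_innApply, mul_assoc, inv_mul_eq_iff_eq_mul] at hb
    exact Subgroup.mem_centralizer_singleton_iff.mpr hb.symm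

theorem fiberMapLinear_bijective {e : Q} (h : Function.Bijective (fiberMap e)) :
    Function.Bijective (fiberMapLinear e) := by
  have hd : Function.Bijective (Finsupp.lmapDomain ℤ ℤ (fiberMap e)) :=
    ⟨Finsupp.mapDomain_injective h.1, Finsupp.mapDomain_surjective h.2⟩
  exact hd.comp (MonoidAlgebra.coeffLinearEquiv ℤ).bijective

theorem fiberMapLinear_single (e : Q) (g : LongitudeGroup (inn e)) :
    fiberMapLinear e (MonoidAlgebra.single g 1) = Finsupp.single (fiberMap e g) 1 := by
  simp [fiberMapLinear]

end InnerAction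

/-! ### Colourings and representations of the knot group -/

namespace GaussCode

variable {D : GaussCode}

/-- The representation of the knot group defined by a solution of the Wirtinger relations whose
values at the two ends agree. -/
def IsWirtinger.toHom {G : Type v} [Group G] {y : D.Edge → G} (hy : D.IsWirtinger y)
    (hends : y D.bottomEdge = y D.topEdge) : D.KnotGroup →* G :=
  PresentedGroup.toGroup (f := y) (by
    rintro r (c | c | _)
    · simp [(hy c).1]
    · simp [(hy c).2, mul_assoc]
    · simp [hends])

theorem IsWirtinger.toHom_gen {G : Type v} [Group G] {y : D.Edge → G} (hy : D.IsWirtinger y)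
    (hends : y D.bottomEdge = y D.topEdge) (i : D.Edge) : hy.toHom hends (D.gen i) = y i :=
  PresentedGroup.toGroup.of _

/-- The product of the factors of the parallel up to an edge. -/
def partialParallel (D : GaussCode) (i : D.Edge) : D.KnotGroup :=
  ((List.ofFn D.parallelFactor).take i).prod

theorem partialParallel_topEdge (D : GaussCode) : D.partialParallel D.topEdge = 1 := by
  simp [partialParallel, topEdge]

theorem partialParallel_succ (D : GaussCode) (t : Fin (2 * D.n)) :
    D.partialParallel t.succ = D.partialParallel t.castSucc * D.parallelFactor t := by
  unfold partialParallel
  rw [Fin.val_succ, List.prod_take_succ _ _ (by simp)]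
  simp

theorem longitude_eq (D : GaussCode) :
    D.longitude = D.meridian ^ (-D.writhe) * D.partialParallel D.bottomEdge := by
  rw [longitude, partialParallel, List.take_of_length_le (by simp [bottomEdge])]

theorem gen_eq (D : GaussCode) (i : D.Edge) :
    D.gen i = (D.partialParallel i)⁻¹ * D.meridian * D.partialParallel i :=
  D.gen_eq_conj i.1 i.2

theorem partialParallel_overOut (D : GaussCode) (c : Fin D.n) :
    D.partialParallel (D.overOut c) = D.partialParallel (D.overIn c) := by
  rw [overOut, partialParallel_succ, ← overIn]
  simp [parallelFactor]

theorem partialParallel_underOut (D : GaussCode) (c : Fin D.n) :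
    D.partialParallel (D.underOut c) =
      D.partialParallel (D.underIn c) * D.gen (D.overIn c) ^ (D.sign c : ℤ) := by
  rw [underOut, partialParallel_succ, ← underIn]
  simp [parallelFactor]

variable {Q : Type u} [Quandle Q]

/-- At a negative crossing the rule is solved for the outgoing colour by inverting the translation,
so both signs become one action by `R ^ ε`, matching the factors of the parallel. -/
theorem isColoring_iff {C : D.Edge → Q} :
    D.IsColoring C ↔ ∀ c, C (D.overOut c) = C (D.overIn c) ∧
      C (D.underOut c) = innApply (C (D.underIn c)) (inn (C (D.overIn c)) ^ (D.sign c : ℤ)) := by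
  refine forall_congr' fun c => and_congr_right fun _ => ?_
  rcases Int.units_eq_one_or (D.sign c) with h | h
  · simp [h, innApply_inn]
  · rw [h]
    simp only [Units.val_neg, Units.val_one, zpow_neg, zpow_one, ← innApply_inn]
    constructor
    · intro H
      rw [H.2 trivial, innApply_inv_innApply]
    · intro H
      exact ⟨fun h => absurd h (by decide), fun _ => by rw [H, innApply_innApply_inv]⟩

/-- The colour of every edge is determined by the colour of the top edge and the representation of
the knot group. -/
theorem IsColoring.eq_innApply {C : D.Edge → Q} (hC : D.IsColoring C) (ρ : D.KnotGroup →* Inn Q)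
    (hρ : ∀ i, ρ (D.gen i) = inn (C i)) (i : D.Edge) :
    C i = innApply (C D.topEdge) (ρ (D.partialParallel i)) := by
  induction i using Fin.induction with
  | zero => rw [← topEdge, partialParallel_topEdge, map_one, innApply_one]
  | succ t ih =>
    -- The passage leading to the next edge is named by its crossing and strand, so that the rule at
    -- that crossing applies.
    obtain ⟨⟨c, b⟩, rfl⟩ := D.passage.symm.surjective t
    obtain ⟨h1, h2⟩ := isColoring_iff.mp hC c
    cases b
    · change C (D.underIn c) = innApply _ (ρ (D.partialParallel (D.underIn c))) at ih
      change C (D.underOut c) = innApply _ (ρ (D.partialParallel (D.underOut c)))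
      rw [h2, partialParallel_underOut, map_mul, innApply_mul, ← ih, map_zpow, hρ]
    · change C (D.overIn c) = innApply _ (ρ (D.partialParallel (D.overIn c))) at ih
      change C (D.overOut c) = innApply _ (ρ (D.partialParallel (D.overOut c)))
      rw [h1, partialParallel_overOut, ih]

variable {e : Q}

/-- Each generator is the meridian conjugated by the partial parallel, and `R_{eg}` is `R_e`
conjugated by `g`. Thus `ρ` can be read off from the colours, which gives both the colouring rule
and injectivity. -/
theorem inn_innApply_partialParallel (ρ : {ρ : D.KnotGroup →* Inn Q // ρ D.meridian = inn e})
    (i : D.Edge) : inn (innApply e (ρ.1 (D.partialParallel i))) = ρ.1 (D.gen i) := by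
  rw [inn_innApply, gen_eq, map_mul, map_mul, map_inv, ρ.2]

/-- The colouring belonging to a representation of the knot group. -/
def coloringOfHom (ρ : {ρ : D.KnotGroup →* Inn Q // ρ D.meridian = inn e}) : D.ColoringFrom e :=
  ⟨fun i => innApply e (ρ.1 (D.partialParallel i)), isColoring_iff.mpr fun c => by
    rw [inn_innApply_partialParallel, partialParallel_overOut, partialParallel_underOut, map_mul,
      innApply_mul, map_zpow]
    exact ⟨rfl, rfl⟩, by
    beta_reduce
    rw [partialParallel_topEdge, map_one, innApply_one]⟩

theorem coloringOfHom_bottomEdge (ρ : {ρ : D.KnotGroup →* Inn Q // ρ D.meridian = inn e}) :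
    (coloringOfHom ρ).1 D.bottomEdge = innApply e (ρ.1 D.longitude) := by
  rw [longitude_eq, map_mul, map_zpow, ρ.2, innApply_mul, innApply_inn_zpow]
  rfl

theorem coloringOfHom_bijective (hD : D.IsPlanar) :
    Function.Bijective (coloringOfHom (D := D) (e := e)) := by
  constructor
  · intro ρ σ h
    apply Subtype.ext
    refine PresentedGroup.ext fun i => ?_
    change ρ.1 (D.gen i) = σ.1 (D.gen i)
    rw [← inn_innApply_partialParallel, ← inn_innApply_partialParallel]
    exact congrArg (fun C : D.ColoringFrom e => inn (C.1 i)) h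
  · rintro ⟨C, hC, rfl⟩
    -- Planarity supplies the closing relation: the end colours may differ, but their translations
    -- agree.
    have hends := hC.isWirtinger.bottom_eq_top hD
    have hρ := hC.isWirtinger.toHom_gen hends
    refine ⟨⟨hC.isWirtinger.toHom hends, hρ _⟩, Subtype.ext (funext fun i => ?_)⟩
    exact (hC.eq_innApply _ hρ i).symm

end GaussCode

/-! ### Comparison of the two invariants -/

theorem psiInvariant_eq {Q : Type u} [Quandle Q] [Finite Q] (e : Q) (K : TangleDiagram) :
    psiInvariant e K = fiberMapLinear e (knotColoringPolynomial (inn e) K) := by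
  unfold psiInvariant knotColoringPolynomial
  rw [map_sum]
  let _ := Fintype.ofFinite (K.ColoringFrom e)
  let _ := Fintype.ofFinite {ρ : K.KnotGroup →* Inn Q // ρ K.meridian = inn e}
  symm
  refine Fintype.sum_bijective _ (GaussCode.coloringOfHom_bijective K.isPlanar) _ _ fun ρ => ?_
  rw [fiberMapLinear_single]
  congr 1
  exact Subtype.ext (GaussCode.coloringOfHom_bottomEdge ρ).symm

theorem mainTheorem2 {Q : Type u} [Quandle Q] [Finite Q] (hconn : IsConnectedQuandle Q)
    (hGAlex : IsGeneralizedAlexander Q) (e : Q) :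
    (Function.Bijective (fiberMap e) ∧ Function.Bijective (fiberMapLinear e)) ∧
    (∀ K : TangleDiagram,
      psiInvariant e K = fiberMapLinear e (knotColoringPolynomial (inn e) K)) ∧
    (∀ K₁ K₂ : TangleDiagram,
      psiInvariant e K₁ ≠ psiInvariant e K₂ ↔
        knotColoringPolynomial (inn e) K₁ ≠ knotColoringPolynomial (inn e) K₂) := by
  have hbij := fiberMap_bijective hconn hGAlex e
  have hlin := fiberMapLinear_bijective hbij
  refine ⟨⟨hbij, hlin⟩, psiInvariant_eq e, fun K₁ K₂ => ?_⟩
  rw [psiInvariant_eq, psiInvariant_eq, hlin.1.ne_iff]
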